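/- All graphs are finite, simple and undirected. A weighted graph $H=(V,E',w)$ on the vertex set of $G=(V,E)$ has nonnegative real edge weights $w$, and $E'$ need not be contained in $E$. Write $\mathrm{dist}_G$ for the shortest-path distance in the unweighted graph $G$ and $\mathrm{dist}_H$ for the weighted shortest-path distance in $H$, the distance being $\infty$ when there is no path. For a real $k\ge 0$, $H$ is a $+k$ additive emulator of $G$ if $\mathrm{dist}_G(s,t)\le \mathrm{dist}_H(s,t)\le \mathrm{dist}_G(s,t)+k$ for all $s,t\in V$. **Theorem.** There is an absolute constant $C$ such that for every $\varepsilon>0$ there is a constant $K_\varepsilon$, depending only on $\varepsilon$, for which the following holds. Every $n$-vertex graph $G$ has a $+k$ additive emulator $H$ with $k = C\,n^{\frac{1}{3+\sqrt5}+\varepsilon}$ and with at most $K_\varepsilon\, n$ edges. -/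

import Mathlib

open scoped NNReal ENNReal

/-- An undirected graph on the vertex set `V` with nonnegative real edge weights. Only the weights of
edges of `graph` are ever used. -/
structure WeightedGraph (V : Type*) where
  /-- The underlying simple graph. -/
  graph : SimpleGraph V
  /-- The weight of an edge. -/
  weight : Sym2 V → ℝ≥0

namespace WeightedGraph

variable {V : Type*}

/-- The total weight of a walk, edges being counted with multiplicity. -/
def walkWeight (H : WeightedGraph V) {s t : V} (p : H.graph.Walk s t) : ℝ≥0 :=
  (p.edges.map H.weight).sum

/-- The shortest-path distance of a weighted graph; it is `∞` when there is no path. -/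
noncomputable def dist (H : WeightedGraph V) (s t : V) : ℝ≥0∞ :=
  ⨅ p : H.graph.Walk s t, (H.walkWeight p : ℝ≥0∞)

/-- `H` is a `+k` additive emulator of the unweighted graph `G`. Distances are extended, so `s` and
`t` are connected in `H` exactly when they are connected in `G`. -/
def IsAdditiveEmulator (H : WeightedGraph V) (G : SimpleGraph V) (k : ℝ≥0) : Prop :=
  ∀ s t : V, (G.edist s t : ℝ≥0∞) ≤ H.dist s t ∧ H.dist s t ≤ (G.edist s t : ℝ≥0∞) + k

/-- The number of edges of a weighted graph (meaningful when there are finitely many). -/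
noncomputable def numEdges (H : WeightedGraph V) : ℕ :=
  H.graph.edgeSet.ncard

end WeightedGraph

/-! Call `a` an emulator exponent if connected graphs have linear-size emulators of error `O(n ^
a)`. A star gives the exponent `1`, and the proof is a bootstrap (`IsEmulatorExponent.improve`): an
exponent `a` in `[0, 1]` yields every `y > 1 / (6 - 4 * a)`. The smaller fixed point of `a ↦ 1 / (6
- 4 * a)` is `(3 - √5) / 4 = 1 / (3 + √5)`, and the other exceeds `1`, so the infimum of the
exponents is at most `1 / (3 + √5)`.

One step of the bootstrap, up to factors `n ^ ε`: `exists_clustering` covers `G` by balls (clusters)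
of radius about `L` and total size `O(n)`, so edges linear in the size of every cluster are
affordable. A random set of density `1 / q`, with `q` slightly below `L`, meets every block of `L`
vertices of the chosen geodesics; its points are milestones. In a cluster with `m ≤ q ^ 2` vertices
all pairs of milestones are joined exactly, at a cost of about `m ^ 2 / q ^ 2 ≤ m` edges. A larger
cluster receives a recursive emulator, of error about `m ^ a ≤ q ^ (2 * (a - 1)) * m`; these errors
sum to `W ≲ n * q ^ (2 * (a - 1))`.

A geodesic through many large clusters may accumulate too much error. Path buying
(`exists_purchase`) then adds one edge from near its start to near its end, which newly serves pairs
of clusters of total weight over `L ^ 2`, out of at most `W ^ 2`. So at most `(W / L) ^ 2` edges are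
bought, and this is `O(n)` once `L ^ (6 - 4 * a) ≳ n`. -/

namespace SimpleGraph

/-! ### Routes through a set of pairs -/

variable {V W : Type*}

/-- `G.Route E s t m` says that `s` and `t` are joined by a sequence of pairs from `E`, each used in
either direction, whose `G`-distances add up to at most `m`. -/
inductive Route (G : SimpleGraph V) (E : Finset (V × V)) : V → V → ℕ → Prop
  | refl (v : V) (m : ℕ) : Route G E v v m
  | cons {u v w : V} {m l : ℕ} (h : (u, v) ∈ E ∨ (v, u) ∈ E) (r : Route G E v w m)
      (hl : G.dist u v + m ≤ l) : Route G E u w l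

namespace Route

variable {G : SimpleGraph V} {E F : Finset (V × V)} {s t u : V} {m l : ℕ}

theorem mono (r : G.Route E s t m) (h : m ≤ l) : G.Route E s t l := by
  cases r with
  | refl => exact .refl _ _
  | cons h' r hl => exact .cons h' r (hl.trans h)

theorem mono_edges (r : G.Route E s t m) (h : E ⊆ F) : G.Route F s t m := by
  induction r with
  | refl => exact .refl _ _
  | cons h' r hl ih => exact .cons (h'.imp (@h _) (@h _)) ih hl

theorem trans (r : G.Route E s t m) (r' : G.Route E t u l) : G.Route E s u (m + l) := by
  induction r with
  | refl => exact r'.mono (by omega)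
  | cons h' r hl ih => exact .cons h' (ih r') (by omega)

theorem single (h : (s, t) ∈ E ∨ (t, s) ∈ E) (hl : G.dist s t ≤ m) : G.Route E s t m :=
  .cons h (.refl _ 0) (by simpa using hl)

theorem symm (r : G.Route E s t m) : G.Route E t s m := by
  induction r with
  | refl => exact .refl _ _
  | @cons a b c m l h' r hl ih =>
    have := ih.trans (single (G := G) h'.symm (le_of_eq (G.dist_comm)) : G.Route E b a (G.dist a b))
    exact this.mono (by omega)

/-- Carries recursive emulators of induced subgraphs back to `G`, where distances can only shrink.
-/
theorem map {G' : SimpleGraph W} {E' : Finset (W × W)} {x y : W} (f : W → V)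
    (hd : ∀ a b, G.dist (f a) (f b) ≤ G'.dist a b) (hE : ∀ a b, (a, b) ∈ E' → (f a, f b) ∈ E)
    (r : G'.Route E' x y m) : G.Route E (f x) (f y) m := by
  induction r with
  | refl => exact .refl _ _
  | cons h' r hl ih =>
    exact .cons (h'.imp (hE _ _) (hE _ _)) ih (le_trans (Nat.add_le_add_right (hd _ _) _) hl)

end Route

/-! ### Induced subgraphs and geodesics -/

theorem Connected.dist_le_dist_induce {G : SimpleGraph V} {C : Set V} (h : (G.induce C).Connected)
    (x y : C) : G.dist x y ≤ (G.induce C).dist x y := by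
  obtain ⟨p, hp⟩ := h.exists_walk_length_eq_dist x y
  rw [← hp, ← Walk.length_map (Embedding.induce C).toHom p]
  exact dist_le _

theorem dist_induce_le {G : SimpleGraph V} {C : Set V} {x y : V} (p : G.Walk x y)
    (hp : ∀ v ∈ p.support, v ∈ C) :
    (G.induce C).Reachable ⟨x, hp x (by simp)⟩ ⟨y, hp y (by simp)⟩ ∧
      (G.induce C).dist ⟨x, hp x (by simp)⟩ ⟨y, hp y (by simp)⟩ ≤ p.length := by
  refine ⟨⟨p.induce C hp⟩, ?_⟩
  refine (dist_le (p.induce C hp)).trans (le_of_eq ?_)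
  rw [← Walk.length_map (Embedding.induce C).toHom, Walk.map_induce]
  rfl

theorem Connected.exists_geodesic {G : SimpleGraph V} (hG : G.Connected) (s t : V) :
    ∃ p : ℕ → V, p 0 = s ∧ p (G.dist s t) = t ∧
      ∀ i j, i ≤ j → j ≤ G.dist s t → G.dist (p i) (p j) = j - i := by
  obtain ⟨p, hp⟩ := hG.exists_walk_length_eq_dist s t
  have hstep : ∀ i j, i ≤ j → j ≤ G.dist s t → G.dist (p.getVert i) (p.getVert j) ≤ j - i := by
    intro i j hij
    induction j, hij using Nat.le_induction with
    | base => simp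
    | succ j hij ih =>
      intro hj
      have h1 := ih (by omega)
      have h2 := hG.dist_triangle (u := p.getVert i) (v := p.getVert j) (w := p.getVert (j + 1))
      have h3 : G.dist (p.getVert j) (p.getVert (j + 1)) = 1 :=
        dist_eq_one_iff_adj.2 (p.adj_getVert_succ (by omega))
      omega
  refine ⟨p.getVert, by simp, by simp [← hp], fun i j hij hj => le_antisymm (hstep i j hij hj) ?_⟩
  have h0 := hstep 0 i (by omega) (by omega)
  have h1 := hstep j _ hj le_rfl
  rw [← hp] at h1
  simp only [Walk.getVert_zero, Walk.getVert_length] at h0 h1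
  have h2 := hG.dist_triangle (u := s) (v := p.getVert i) (w := t)
  have h3 := hG.dist_triangle (u := p.getVert i) (v := p.getVert j) (w := t)
  omega

/-- If the ball of radius `r` around `x` lies in `C`, then `G.induce C` preserves the distance
from `x` to every point of that ball. -/
theorem Connected.dist_induce_le_of_ball {G : SimpleGraph V} (hG : G.Connected) {C : Set V} {x y : V}
    (hx : x ∈ C) (hy : y ∈ C) (hC : ∀ v, G.dist x v ≤ G.dist x y → v ∈ C) :
    (G.induce C).Reachable ⟨x, hx⟩ ⟨y, hy⟩ ∧
      (G.induce C).dist ⟨x, hx⟩ ⟨y, hy⟩ ≤ G.dist x y := by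
  classical
  obtain ⟨p, hp⟩ := hG.exists_walk_length_eq_dist x y
  have h : ∀ v ∈ p.support, v ∈ C := fun v hv => hC v <|
    (dist_le (p.takeUntil v hv)).trans ((p.length_takeUntil_le_length hv).trans hp.le)
  exact hp ▸ dist_induce_le p h

end SimpleGraph

/-! ### Weighted graphs from sets of pairs -/

namespace WeightedGraph

open SimpleGraph

variable {V : Type*}

/-- The weighted graph whose edges are the pairs in `E` of distinct vertices of the same component,
weighted by their distance in `G`. -/
noncomputable def ofPairs (G : SimpleGraph V) (E : Finset (V × V)) : WeightedGraph V where
  graph :=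
    { Adj := fun x y => x ≠ y ∧ G.Reachable x y ∧ ((x, y) ∈ E ∨ (y, x) ∈ E)
      symm := ⟨fun _ _ h => ⟨h.1.symm, h.2.1.symm, h.2.2.symm⟩⟩
      loopless := ⟨fun _ h => h.1 rfl⟩ }
  weight := Sym2.lift ⟨fun x y => (G.dist x y : ℝ≥0), fun _ _ => by simp only [G.dist_comm]⟩

theorem numEdges_ofPairs_le (G : SimpleGraph V) (E : Finset (V × V)) :
    (ofPairs G E).numEdges ≤ E.card := by
  classical
  refine (Set.ncard_le_ncard (t := ↑(E.image fun p : V × V => s(p.1, p.2))) ?_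
    (Finset.finite_toSet _)).trans ?_
  · intro e
    induction e using Sym2.ind with
    | _ x y =>
      intro he
      obtain ⟨-, -, h | h⟩ := (SimpleGraph.mem_edgeSet _).1 he
      · exact Finset.mem_coe.2 (Finset.mem_image.2 ⟨_, h, rfl⟩)
      · exact Finset.mem_coe.2 (Finset.mem_image.2 ⟨_, h, Sym2.eq_swap⟩)
  · rw [Set.ncard_coe_finset]
    exact Finset.card_image_le

theorem le_walkWeight_ofPairs {G : SimpleGraph V} {E : Finset (V × V)} {s t : V}
    (p : (ofPairs G E).graph.Walk s t) :
    G.Reachable s t ∧ (G.dist s t : ℝ≥0) ≤ (ofPairs G E).walkWeight p := by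
  induction p with
  | nil => simp [walkWeight]
  | @cons u v w h p ih =>
    refine ⟨h.2.1.trans ih.1, ?_⟩
    have : (G.dist u w : ℝ≥0) ≤ G.dist u v + G.dist v w := by
      exact_mod_cast h.2.1.dist_triangle_left w
    refine this.trans ?_
    simp only [walkWeight, Walk.edges_cons, List.map_cons, List.sum_cons]
    exact add_le_add le_rfl ih.2

theorem exists_walkWeight_ofPairs_le {G : SimpleGraph V} {E : Finset (V × V)} {s t : V} {m : ℕ}
    (hE : ∀ x y, (x, y) ∈ E → G.Reachable x y) (r : G.Route E s t m) :
    ∃ p : (ofPairs G E).graph.Walk s t, (ofPairs G E).walkWeight p ≤ m := by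
  induction r with
  | refl => exact ⟨.nil, by simp [walkWeight]⟩
  | @cons u v w m l h r hl ih =>
    obtain ⟨p, hp⟩ := ih
    by_cases huv : u = v
    · subst huv
      exact ⟨p, hp.trans (by exact_mod_cast (by omega : m ≤ l))⟩
    · have hr : G.Reachable u v := h.elim (hE _ _) (fun h => (hE _ _ h).symm)
      refine ⟨.cons ⟨huv, hr, h⟩ p, ?_⟩
      have : (G.dist u v : ℝ≥0) + m ≤ l := by exact_mod_cast hl
      refine le_trans ?_ this
      exact add_le_add le_rfl hp

/-- Weights equal to distances make the lower bound automatic, so only routes have to be found. `hE`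
turns the pairs of a route into edges: `G.dist` is `0` across components, so `ofPairs` must discard
pairs joining different ones. -/
theorem isAdditiveEmulator_ofPairs {G : SimpleGraph V} {E : Finset (V × V)} {k : ℝ≥0}
    (hE : ∀ x y, (x, y) ∈ E → G.Reachable x y)
    (h : ∀ s t, G.Reachable s t → ∃ m : ℕ, (m : ℝ≥0) ≤ k ∧ G.Route E s t (G.dist s t + m)) :
    (ofPairs G E).IsAdditiveEmulator G k := by
  intro s t
  have hdist : G.Reachable s t → (G.edist s t : ℝ≥0∞) = ((G.dist s t : ℝ≥0) : ℝ≥0∞) := by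
    intro hst
    rw [← hst.coe_dist_eq_edist]
    simp
  constructor
  · refine le_iInf fun p => ?_
    obtain ⟨hst, hp⟩ := le_walkWeight_ofPairs p
    rw [hdist hst]
    exact_mod_cast hp
  · by_cases hst : G.Reachable s t
    · obtain ⟨m, hm, r⟩ := h s t hst
      obtain ⟨p, hp⟩ := exists_walkWeight_ofPairs_le hE r
      refine (iInf_le _ p).trans ?_
      rw [hdist hst]
      have : (ofPairs G E).walkWeight p ≤ G.dist s t + k := by
        refine hp.trans ?_
        push_cast
        gcongr
      exact_mod_cast this
    · simp [edist_eq_top_of_not_reachable hst]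

end WeightedGraph

/-! ### Clustering by balls -/

namespace SimpleGraph

variable {V : Type*} [Fintype V]

open Classical in
/-- The vertices at distance at most `r` from `u`. -/
noncomputable def distBall (G : SimpleGraph V) (u : V) (r : ℕ) : Finset V :=
  Finset.univ.filter fun x => G.dist u x ≤ r

theorem mem_distBall {G : SimpleGraph V} {u x : V} {r : ℕ} :
    x ∈ G.distBall u r ↔ G.dist u x ≤ r := by
  simp [distBall]

theorem distBall_nonempty (G : SimpleGraph V) (u : V) (r : ℕ) : (G.distBall u r).Nonempty :=
  ⟨u, by simp [mem_distBall]⟩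

theorem Connected.induce_distBall {G : SimpleGraph V} (hG : G.Connected) (u : V) (r : ℕ) :
    (G.induce (G.distBall u r : Set V)).Connected := by
  have hu : u ∈ (G.distBall u r : Set V) := by simp [mem_distBall]
  refine connected_iff_exists_forall_reachable _ |>.2 ⟨⟨u, hu⟩, fun ⟨x, hx⟩ => ?_⟩
  refine (hG.dist_induce_le_of_ball hu hx fun v hv => ?_).1
  exact Finset.mem_coe.2 (mem_distBall.2 (hv.trans (mem_distBall.1 (Finset.mem_coe.1 hx))))

/-- Some ball in a geometric sequence of radii grows by a factor of at most `K`. -/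
theorem exists_card_distBall_le (G : SimpleGraph V) {K J : ℕ} (hJ : Fintype.card V < K ^ J)
    (b L : ℕ) (u : V) :
    ∃ j < J, (G.distBall u (b ^ (j + 1) * L)).card ≤ K * (G.distBall u (b ^ j * L)).card := by
  by_contra! h
  have key : ∀ j ≤ J, K ^ j ≤ (G.distBall u (b ^ j * L)).card := by
    intro j
    induction j with
    | zero => exact fun _ => by simpa using (G.distBall_nonempty u _).card_pos
    | succ j ih =>
      intro hj
      rw [pow_succ']
      exact (Nat.mul_le_mul_left K (ih (by omega))).trans (h j (by omega)).le
  exact absurd ((key J le_rfl).trans (Finset.card_le_univ _)) (by omega)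

/-- A family of balls of radius about `L` with bounded total size such that the `5 * L`-ball of every
vertex lies in one of them. -/
theorem Connected.exists_clustering {G : SimpleGraph V} (hG : G.Connected) {K J : ℕ}
    (hJ : Fintype.card V < K ^ J) (L : ℕ) :
    ∃ (U : Finset V) (rad : V → ℕ) (c : V → V),
      (∀ v, c v ∈ U ∧ ∀ x, G.dist v x ≤ 5 * L → x ∈ G.distBall (c v) (rad (c v))) ∧
      (∀ u, rad u ≤ 8 ^ J * L) ∧
      ∑ u ∈ U, (G.distBall u (rad u)).card ≤ K * Fintype.card V := by
  classical
  choose j hj hcard using G.exists_card_distBall_le hJ 8 L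
  -- Every inner ball meets a selected one of some radius `r` at least half its own, so the `5 *
  -- L`-ball of its centre lies within `r + 2 * r + 5 * L ≤ 8 * r` of the selected centre: hence the
  -- ratio `8`. The selected inner balls are disjoint, and enlarging them costs a factor `K`.
  obtain ⟨u, -, hdisj, hcov⟩ := Vitali.exists_disjoint_subfamily_covering_enlargement
    (fun v => (G.distBall v (8 ^ j v * L) : Set V)) Set.univ (fun v => ((8 ^ j v * L : ℕ) : ℝ)) 2
    (by norm_num) (fun _ _ => by positivity) ((8 ^ J * L : ℕ) : ℝ)
    (fun v _ => by
      exact_mod_cast Nat.mul_le_mul_right L (Nat.pow_le_pow_right (by norm_num) (hj v).le))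
    (fun v _ => by exact_mod_cast G.distBall_nonempty v _)
  have hcov' : ∀ v, ∃ b ∈ u, ∃ x, G.dist v x ≤ 8 ^ j v * L ∧ G.dist b x ≤ 8 ^ j b * L ∧
      8 ^ j v * L ≤ 2 * (8 ^ j b * L) := by
    intro v
    obtain ⟨b, hb, ⟨x, hx⟩, hr⟩ := hcov v (Set.mem_univ _)
    refine ⟨b, hb, x, mem_distBall.1 (Finset.mem_coe.1 hx.1), mem_distBall.1 (Finset.mem_coe.1 hx.2),
      by exact_mod_cast hr⟩
  choose c hcu y hy1 hy2 hr using hcov'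
  refine ⟨u.toFinset, fun v => 8 ^ (j v + 1) * L, c, fun v => ⟨by simpa using hcu v, fun x hx => ?_⟩,
    fun v => Nat.mul_le_mul_right L (Nat.pow_le_pow_right (by norm_num) (hj v)), ?_⟩
  · rw [mem_distBall]
    change _ ≤ 8 ^ (j (c v) + 1) * L
    have h1 := hG.dist_triangle (u := c v) (v := y v) (w := x)
    have h2 := hG.dist_triangle (u := y v) (v := v) (w := x)
    have h3 := hy1 v
    have h4 := hy2 v
    have h5 := hr v
    have h6 : L ≤ 8 ^ j (c v) * L := Nat.le_mul_of_pos_left L (by positivity)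
    rw [G.dist_comm (u := y v) (v := v)] at h2
    have h7 : 8 ^ (j (c v) + 1) * L = 8 * (8 ^ j (c v) * L) := by ring
    omega
  · calc ∑ v ∈ u.toFinset, (G.distBall v (8 ^ (j v + 1) * L)).card
        ≤ ∑ v ∈ u.toFinset, K * (G.distBall v (8 ^ j v * L)).card :=
          Finset.sum_le_sum fun v _ => hcard v
      _ = K * (u.toFinset.biUnion fun v => G.distBall v (8 ^ j v * L)).card := by
          rw [← Finset.mul_sum, Finset.card_biUnion]
          intro a ha b hb hab
          exact Finset.disjoint_coe.1 (hdisj (by simpa using ha) (by simpa using hb) hab)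
      _ ≤ K * Fintype.card V := Nat.mul_le_mul_left K (Finset.card_le_univ _)

end SimpleGraph

/-! ### Random hitting sets -/

section HittingSet

open Finset

variable {V : Type*} [Fintype V] [DecidableEq V]

theorem card_filter_pair_mul_sq {q : ℕ} [NeZero q] {x y : V} (hxy : x ≠ y) :
    (univ.filter fun f : V → Fin q => f x = 0 ∧ f y = 0).card * q ^ 2 = q ^ Fintype.card V := by
  have h : (univ.filter fun f : V → Fin q => f x = 0 ∧ f y = 0) =
      Fintype.piFinset fun v => if v ∈ ({x, y} : Finset V) then {0} else univ := by
    ext f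
    simp only [mem_filter, mem_univ, true_and, Fintype.mem_piFinset]
    refine ⟨fun h v => ?_, fun h => ⟨by simpa using h x, by simpa using h y⟩⟩
    split_ifs with hv
    · rcases mem_insert.1 hv with rfl | hv
      · simpa using h.1
      · rw [mem_singleton.1 hv]; simpa using h.2
    · simp
  rw [h, Fintype.card_piFinset]
  simp only [apply_ite card, card_singleton, card_univ, Fintype.card_fin]
  rw [prod_ite, prod_const_one, one_mul, prod_const, ← card_pair hxy, ← pow_add]
  congr 1
  have := card_filter_add_card_filter_not (s := (univ : Finset V)) (fun v => v ∈ ({x, y} : Finset V))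
  rw [filter_mem_eq_inter, univ_inter, card_univ] at this
  omega

theorem card_filter_disjoint_mul {q : ℕ} [NeZero q] (A : Finset V) :
    (univ.filter fun f : V → Fin q => ∀ a ∈ A, f a ≠ 0).card * q ^ A.card =
      (q - 1) ^ A.card * q ^ Fintype.card V := by
  have h : (univ.filter fun f : V → Fin q => ∀ a ∈ A, f a ≠ 0) =
      Fintype.piFinset fun v => if v ∈ A then univ.erase 0 else univ := by
    ext f
    simp only [mem_filter, mem_univ, true_and, Fintype.mem_piFinset]
    refine ⟨fun h v => ?_, fun h v hv => by simpa [hv] using h v⟩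
    split_ifs with hv
    · simpa using h v hv
    · simp
  rw [h, Fintype.card_piFinset]
  simp only [apply_ite card, card_erase_of_mem (mem_univ _), card_univ, Fintype.card_fin]
  rw [prod_ite, prod_const, prod_const, mul_assoc, ← pow_add]
  have := card_filter_add_card_filter_not (s := (univ : Finset V)) (fun v => v ∈ A)
  rw [filter_mem_eq_inter, univ_inter, card_univ] at this
  rw [filter_mem_eq_inter, univ_inter]
  congr 2
  omega

/-- A set meeting all the sets `A i` of size at least `L` that contains few pairs of points lying in
a common `B k`. -/
theorem exists_hittingSet {ι κ : Type*} [Fintype ι] (A : ι → Finset V) (s : Finset κ)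
    (B : κ → Finset V) {L q : ℕ} (hq : 0 < q) (hA : ∀ i, L ≤ (A i).card)
    (hL : 2 * (Fintype.card ι : ℝ) * (1 - 1 / q) ^ L ≤ 1) :
    ∃ X : Finset V, (∀ i, (X ∩ A i).Nonempty) ∧
      ((∑ k ∈ s, (X ∩ B k).offDiag.card : ℕ) : ℝ) ≤
        2 * (∑ k ∈ s, ((B k).card : ℝ) ^ 2 / q ^ 2) + 1 := by
  classical
  have : NeZero q := ⟨hq.ne'⟩
  have hq' : (0 : ℝ) < q := by exact_mod_cast hq
  set S : ℝ := ∑ k ∈ s, ((B k).card : ℝ) ^ 2 / q ^ 2 with hS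
  have hS0 : 0 ≤ S := sum_nonneg fun _ _ => by positivity
  set N : ℝ := (q : ℝ) ^ Fintype.card V with hN
  have hN0 : 0 < N := by positivity
  -- For a uniform `f` the zero class contains each vertex independently with probability `1 / q`.
  let X : (V → Fin q) → Finset V := fun f => univ.filter fun v => f v = 0
  let pairs : (V → Fin q) → ℝ := fun f => ∑ k ∈ s, ((X f ∩ B k).offDiag.card : ℝ)
  let miss : (V → Fin q) → ℝ := fun f => ∑ i, if ∀ a ∈ A i, f a ≠ 0 then (1 : ℝ) else 0
  have hpairs : ∑ f, pairs f ≤ N * S := by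
    have h1 : ∀ k, ∑ f : V → Fin q, ((X f ∩ B k).offDiag.card : ℝ) ≤
        N * (((B k).card : ℝ) ^ 2 / q ^ 2) := by
      intro k
      have h2 : ∀ f : V → Fin q, ((X f ∩ B k).offDiag.card : ℝ) =
          ∑ p ∈ (B k).offDiag, if f p.1 = 0 ∧ f p.2 = 0 then (1 : ℝ) else 0 := by
        intro f
        rw [sum_boole]
        congr 2
        ext p
        simp only [X, mem_offDiag, mem_inter, mem_filter, mem_univ, true_and]
        tauto
      have h3 : ∀ p ∈ (B k).offDiag, (∑ f : V → Fin q, if f p.1 = 0 ∧ f p.2 = 0 then (1 : ℝ) else 0) =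
          N / q ^ 2 := by
        intro p hp
        rw [sum_boole, eq_div_iff (by positivity), hN]
        exact_mod_cast card_filter_pair_mul_sq (mem_offDiag.1 hp).2.2
      simp_rw [h2]
      rw [sum_comm, sum_congr rfl h3, sum_const, nsmul_eq_mul]
      have h4 : ((B k).offDiag.card : ℝ) ≤ ((B k).card : ℝ) ^ 2 := by
        have : (B k).offDiag.card ≤ (B k).card ^ 2 := by
          rw [offDiag_card, sq]; exact Nat.sub_le _ _
        exact_mod_cast this
      calc ((B k).offDiag.card : ℝ) * (N / q ^ 2) ≤ ((B k).card : ℝ) ^ 2 * (N / q ^ 2) := by gcongr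
        _ = _ := by ring
    calc ∑ f, pairs f = ∑ k ∈ s, ∑ f : V → Fin q, ((X f ∩ B k).offDiag.card : ℝ) := sum_comm
      _ ≤ ∑ k ∈ s, N * (((B k).card : ℝ) ^ 2 / q ^ 2) := sum_le_sum fun k _ => h1 k
      _ = N * S := by rw [hS, mul_sum]
  have hmiss : ∑ f, miss f ≤ N * (1 / 2) := by
    have h1 : ∀ i, (∑ f : V → Fin q, if ∀ a ∈ A i, f a ≠ 0 then (1 : ℝ) else 0) ≤
        N * (1 - 1 / q) ^ L := by
      intro i
      rw [sum_boole]
      have h2 : ((univ.filter fun f : V → Fin q => ∀ a ∈ A i, f a ≠ 0).card : ℝ) * q ^ (A i).card =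
          (q - 1) ^ (A i).card * N := by
        rw [hN]
        have := card_filter_disjoint_mul (q := q) (A i)
        rw [← Nat.cast_pred hq]
        exact_mod_cast this
      have h01 : (0 : ℝ) ≤ 1 - 1 / q ∧ (1 : ℝ) - 1 / q ≤ 1 := by
        have : (1 : ℝ) / q ≤ 1 := by
          rw [div_le_one hq']; exact_mod_cast hq
        have : (0 : ℝ) ≤ 1 / q := by positivity
        constructor <;> linarith
      have h3 : ((univ.filter fun f : V → Fin q => ∀ a ∈ A i, f a ≠ 0).card : ℝ) =
          N * (1 - 1 / q) ^ (A i).card := by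
        rw [one_sub_div hq'.ne', div_pow, mul_div_assoc', eq_div_iff (by positivity), h2, mul_comm]
      rw [h3]
      exact mul_le_mul_of_nonneg_left (pow_le_pow_of_le_one h01.1 h01.2 (hA i)) hN0.le
    calc ∑ f, miss f = ∑ i, ∑ f : V → Fin q, (if ∀ a ∈ A i, f a ≠ 0 then (1 : ℝ) else 0) := sum_comm
      _ ≤ ∑ i : ι, N * (1 - 1 / q) ^ L := sum_le_sum fun i _ => h1 i
      _ = N * (Fintype.card ι * (1 - 1 / q) ^ L) := by
        rw [sum_const, card_univ, nsmul_eq_mul]; ring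
      _ ≤ N * (1 / 2) := by
        refine mul_le_mul_of_nonneg_left ?_ hN0.le
        linarith
  -- Each missed set is fined `2 * S + 1`. The mean is at most `S + (2 * S + 1) / 2`, less than one
  -- fine, so an `f` not above the mean misses nothing.
  obtain ⟨f, -, hf⟩ : ∃ f ∈ (univ : Finset (V → Fin q)),
      pairs f + (2 * S + 1) * miss f ≤ 2 * S + 1 / 2 := by
    clear_value S N pairs miss
    refine exists_le_of_sum_le univ_nonempty ?_
    rw [sum_add_distrib, ← mul_sum, sum_const, card_univ, Fintype.card_fun, Fintype.card_fin,
      nsmul_eq_mul]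
    push_cast
    rw [← hN]
    have := mul_le_mul_of_nonneg_left hmiss (by linarith : (0 : ℝ) ≤ 2 * S + 1)
    linarith
  have hp0 : 0 ≤ pairs f := sum_nonneg fun _ _ => by positivity
  have hm0 : 0 ≤ miss f := sum_nonneg fun _ _ => by split_ifs <;> norm_num
  refine ⟨X f, fun i => ?_, ?_⟩
  · by_contra hne
    have hi : ∀ a ∈ A i, f a ≠ 0 := fun a ha h0 =>
      hne ⟨a, mem_inter.2 ⟨by simpa [X] using h0, ha⟩⟩
    have : (1 : ℝ) ≤ miss f := by
      have := single_le_sum (f := fun i => if ∀ a ∈ A i, f a ≠ 0 then (1 : ℝ) else 0)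
        (fun _ _ => by split_ifs <;> norm_num) (mem_univ i)
      exact (if_pos hi).ge.trans this
    nlinarith
  · push_cast
    have : 0 ≤ (2 * S + 1) * miss f := mul_nonneg (by linarith) hm0
    change pairs f ≤ _
    linarith

end HittingSet

/-! ### Milestones on geodesics -/

namespace SimpleGraph

open Finset

variable {V : Type*}

theorem injOn_of_geodesic {G : SimpleGraph V} {p : ℕ → V} {D : ℕ}
    (hp : ∀ i j, i ≤ j → j ≤ D → G.dist (p i) (p j) = j - i) : Set.InjOn p (Set.Iic D) := by
  intro i hi j hj hij
  rcases le_total i j with h | h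
  · have := hp i j h hj
    rw [hij, dist_self] at this
    omega
  · have := hp j i h hi
    rw [hij, dist_self] at this
    omega

theorem Connected.dist_lt_card [Fintype V] {G : SimpleGraph V} (hG : G.Connected) (s t : V) :
    G.dist s t < Fintype.card V := by
  classical
  obtain ⟨p, -, -, hp⟩ := hG.exists_geodesic s t
  have h := card_image_of_injOn (s := range (G.dist s t + 1)) (f := p)
    ((injOn_of_geodesic hp).mono fun i hi => Nat.lt_succ_iff.1 (mem_range.1 (mem_coe.1 hi)))
  rw [card_range] at h
  have := card_le_univ ((range (G.dist s t + 1)).image p)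
  omega

/-- A set `X` meeting every block of `L` consecutive vertices of suitable geodesics, with few pairs
of points in common sets `B k`. -/
theorem Connected.exists_milestones [Fintype V] [DecidableEq V] {G : SimpleGraph V} (hG : G.Connected)
    {κ : Type*} (U : Finset κ) (B : κ → Finset V) {L q : ℕ} (hL0 : 0 < L) (hq : 0 < q)
    (hL : 2 * (Fintype.card V : ℝ) ^ 3 * (1 - 1 / q) ^ L ≤ 1) :
    ∃ X : Finset V,
      ((∑ k ∈ U, (X ∩ B k).offDiag.card : ℕ) : ℝ) ≤
        2 * (∑ k ∈ U, ((B k).card : ℝ) ^ 2 / q ^ 2) + 1 ∧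
      ∀ s t, ∃ (p : ℕ → V) (pos : ℕ → ℕ), p 0 = s ∧ p (G.dist s t) = t ∧
        (∀ i j, i ≤ j → j ≤ G.dist s t → G.dist (p i) (p j) = j - i) ∧
        ∀ i, (i + 1) * L ≤ G.dist s t → i * L ≤ pos i ∧ pos i < (i + 1) * L ∧ p (pos i) ∈ X := by
  classical
  choose p hp0 hpt hp using hG.exists_geodesic
  -- Blocks are indexed by two endpoints and a position below `Fintype.card V`, whence the cube in
  -- `hL`.
  let ι := {x : V × V × Fin (Fintype.card V) // (x.2.2 + 1) * L ≤ G.dist x.1 x.2.1}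
  have hι : Fintype.card ι ≤ Fintype.card V ^ 3 := by
    refine (Fintype.card_subtype_le _).trans (le_of_eq ?_)
    simp only [Fintype.card_prod, Fintype.card_fin]
    ring
  have h01 : (0 : ℝ) ≤ 1 - 1 / q := by
    have hq' : (0 : ℝ) < q := by exact_mod_cast hq
    have : (1 : ℝ) / q ≤ 1 := by rw [div_le_one hq']; exact_mod_cast hq
    linarith
  obtain ⟨X, hX, hcard⟩ := exists_hittingSet (ι := ι)
    (fun x => (Ico (x.1.2.2 * L) ((x.1.2.2 + 1) * L)).image (p x.1.1 x.1.2.1)) U B (L := L) hq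
    (fun x => by
      rw [card_image_of_injOn, Nat.card_Ico, add_mul, one_mul, Nat.add_sub_cancel_left]
      refine (injOn_of_geodesic (hp x.1.1 x.1.2.1)).mono fun i hi => ?_
      exact (mem_Ico.1 (mem_coe.1 hi)).2.le.trans x.2)
    (le_trans (by gcongr; exact_mod_cast hι) hL)
  refine ⟨X, hcard, fun s t => ?_⟩
  have : ∀ i, ∃ a, (i + 1) * L ≤ G.dist s t → i * L ≤ a ∧ a < (i + 1) * L ∧ p s t a ∈ X := by
    intro i
    by_cases hi : (i + 1) * L ≤ G.dist s t
    · have hin : i < Fintype.card V := by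
        have := hG.dist_lt_card s t
        have : i + 1 ≤ (i + 1) * L := Nat.le_mul_of_pos_right _ hL0
        omega
      obtain ⟨v, hv⟩ := hX ⟨(s, t, ⟨i, hin⟩), hi⟩
      obtain ⟨hvX, hv⟩ := mem_inter.1 hv
      obtain ⟨a, ha, rfl⟩ := mem_image.1 hv
      exact ⟨a, fun _ => ⟨(mem_Ico.1 ha).1, (mem_Ico.1 ha).2, hvX⟩⟩
    · exact ⟨0, fun h => absurd h hi⟩
  choose pos hpos using this
  exact ⟨p s t, pos, hp0 s t, hpt s t, hp s t, hpos⟩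

/-! ### Path buying -/

section PathBuying

/-- A sequence of vertices `h 0, …, h N` along a geodesic, where the step from `h i` to `h (i + 1)` is
made inside a cluster with centre `c i` at an extra cost of `w (c i)`. -/
structure IsItinerary (G : SimpleGraph V) (E : Finset (V × V)) (U : Finset V) (w : V → ℕ)
    (ρ μ N : ℕ) (h c : ℕ → V) : Prop where
  mem : ∀ i < N, c i ∈ U
  dist_add : ∀ i j k, i ≤ j → j ≤ k → k ≤ N →
    G.dist (h i) (h k) = G.dist (h i) (h j) + G.dist (h j) (h k)
  step : ∀ i < N, G.Route E (h i) (h (i + 1)) (G.dist (h i) (h (i + 1)) + w (c i))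
  entry : ∀ i < N, G.Route E (c i) (h i) ρ ∧ G.dist (c i) (h i) ≤ ρ
  exit : ∀ i < N, G.Route E (c i) (h (i + 1)) ρ ∧ G.dist (c i) (h (i + 1)) ≤ ρ
  card_le : ∀ (I : Finset ℕ) (u : V), (∀ i ∈ I, i < N ∧ c i = u) → I.card ≤ μ

variable {G : SimpleGraph V} {E E' : Finset (V × V)} {U : Finset V} {w : V → ℕ} {ρ μ N : ℕ}
  {h c : ℕ → V}

namespace IsItinerary

theorem route (it : G.IsItinerary E U w ρ μ N h c) {i j : ℕ} (hij : i ≤ j) (hj : j ≤ N) :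
    G.Route E (h i) (h j) (G.dist (h i) (h j) + ∑ l ∈ Ico i j, w (c l)) := by
  induction j, hij using Nat.le_induction with
  | base => exact .refl _ _
  | succ j hij ih =>
    refine ((ih (by omega)).trans (it.step j (by omega))).mono ?_
    rw [it.dist_add i j (j + 1) hij (by omega) hj, sum_Ico_succ_top hij]
    omega

/-- Each cluster is charged at most `μ` times, so the cost of a stretch is controlled by the set of
clusters it meets. -/
theorem sum_le [DecidableEq V] (it : G.IsItinerary E U w ρ μ N h c) {i j : ℕ} (hj : j ≤ N) :
    ∑ l ∈ Ico i j, w (c l) ≤ μ * ∑ u ∈ (Ico i j).image c, w u := by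
  rw [sum_comp w c, mul_sum]
  refine sum_le_sum fun u _ => ?_
  rw [smul_eq_mul]
  refine Nat.mul_le_mul_right _ (it.card_le _ u fun l hl => ?_)
  obtain ⟨h1, h2⟩ := mem_filter.1 hl
  exact ⟨(mem_Ico.1 h1).2.trans_le hj, h2⟩

/-- Either `E'` contains a short route along the itinerary, or a single new edge provides short
routes between many pairs of cluster centres. -/
theorem route_or_exists_edge [DecidableEq V] (it : G.IsItinerary E U w ρ μ N h c)
    (hG : G.Connected) (hE : E ⊆ E') (T : ℕ) :
    G.Route E' (h 0) (h N) (G.dist (h 0) (h N) + (8 * ρ + 4 * (μ * T))) ∨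
    ∃ (e : V × V) (A B : Finset V), A ⊆ U ∧ B ⊆ U ∧ T < ∑ u ∈ A, w u ∧ T < ∑ u ∈ B, w u ∧
      ∀ u ∈ A, ∀ v ∈ B, ¬ G.Route E' u v (G.dist u v + (4 * ρ + 2 * (μ * T))) ∧
        G.Route (insert e E') u v (G.dist u v + (4 * ρ + 2 * (μ * T))) := by
  by_cases hR : G.Route E' (h 0) (h N) (G.dist (h 0) (h N) + (8 * ρ + 4 * (μ * T)))
  · exact .inl hR
  right
  have hfree : 2 * (μ * T) < ∑ l ∈ Ico 0 N, w (c l) := by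
    by_contra! hle
    exact hR (((it.route (Nat.zero_le N) le_rfl).mono_edges hE).mono (by omega))
  have hbound : ∀ {i j : ℕ}, j ≤ N → ∑ u ∈ (Ico i j).image c, w u ≤ T →
      ∑ l ∈ Ico i j, w (c l) ≤ μ * T := fun hj hT =>
    (it.sum_le hj).trans (Nat.mul_le_mul_left μ hT)
  have hP : T < ∑ u ∈ (Ico 0 N).image c, w u := by
    by_contra! hle
    have := hbound le_rfl hle
    omega
  -- Step `α` is the one whose cluster first brings the weight of the clusters met above `T`; `β`
  -- plays the same role from the other end.
  obtain ⟨α, hαN, hα, hα'⟩ : ∃ α < N, T < ∑ u ∈ (Ico 0 (α + 1)).image c, w u ∧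
      ∑ u ∈ (Ico 0 α).image c, w u ≤ T := by
    have hex : ∃ i, T < ∑ u ∈ (Ico 0 i).image c, w u := ⟨N, hP⟩
    have h1 := Nat.find_spec hex
    have h2 : Nat.find hex ≠ 0 := fun h0 => by rw [h0] at h1; simp at h1
    obtain ⟨α, hα⟩ := Nat.exists_eq_succ_of_ne_zero h2
    have h3 := Nat.find_min hex (m := α) (by omega)
    have h4 := Nat.find_min' hex hP
    rw [hα] at h1
    exact ⟨α, by omega, h1, by omega⟩
  obtain ⟨β, hβN, hβ, hβ'⟩ : ∃ β < N, T < ∑ u ∈ (Ico β N).image c, w u ∧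
      ∑ u ∈ (Ico (β + 1) N).image c, w u ≤ T := by
    have hex : ∃ i, T < ∑ u ∈ (Ico (N - i) N).image c, w u := ⟨N, by simpa using hP⟩
    have h1 := Nat.find_spec hex
    have h2 : Nat.find hex ≠ 0 := fun h0 => by rw [h0] at h1; simp at h1
    have h4 := Nat.find_min' hex (m := N) (by simpa using hP)
    have h3 := Nat.find_min hex (m := Nat.find hex - 1) (by omega)
    refine ⟨N - Nat.find hex, by omega, h1, ?_⟩
    rw [show N - Nat.find hex + 1 = N - (Nat.find hex - 1) by omega]
    omega
  have hsα := hbound hαN.le hα'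
  have hsβ := hbound le_rfl hβ'
  -- Otherwise the cheap prefix and suffix would cover the itinerary, at a cost of at most `2 * (μ *
  -- T)`.
  have hαβ : α ≤ β := by
    by_contra! hlt
    have h1 : ∑ l ∈ Ico 0 N, w (c l) =
        ∑ l ∈ Ico 0 (β + 1), w (c l) + ∑ l ∈ Ico (β + 1) N, w (c l) :=
      (sum_Ico_consecutive _ (Nat.zero_le _) hβN).symm
    have h2 : ∑ l ∈ Ico 0 (β + 1), w (c l) ≤ ∑ l ∈ Ico 0 α, w (c l) :=
      sum_le_sum_of_subset (Ico_subset_Ico le_rfl hlt)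
    omega
  -- The new edge skips the expensive middle, leaving only cheap steps on either side of it.
  refine ⟨(h α, h (β + 1)), (Ico 0 (α + 1)).image c, (Ico β N).image c, ?_, ?_, hα, hβ, ?_⟩
  · intro u hu
    obtain ⟨i, hi, rfl⟩ := mem_image.1 hu
    exact it.mem i (by have := (mem_Ico.1 hi).2; omega)
  · intro u hu
    obtain ⟨i, hi, rfl⟩ := mem_image.1 hu
    exact it.mem i (mem_Ico.1 hi).2
  intro u hu v hv
  obtain ⟨i, hi, rfl⟩ := mem_image.1 hu
  obtain ⟨j, hj, rfl⟩ := mem_image.1 hv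
  obtain ⟨-, hi⟩ := mem_Ico.1 hi
  obtain ⟨hj, hjN⟩ := mem_Ico.1 hj
  obtain ⟨ri, di⟩ := it.entry i (by omega)
  obtain ⟨rj, dj⟩ := it.exit j hjN
  have t1 := hG.dist_triangle (u := c i) (v := h i) (w := c j)
  have t2 := hG.dist_triangle (u := h i) (v := h (j + 1)) (w := c j)
  have t3 := hG.dist_triangle (u := h i) (v := c i) (w := h (j + 1))
  have t4 := hG.dist_triangle (u := c i) (v := c j) (w := h (j + 1))
  rw [G.dist_comm (u := h (j + 1)) (v := c j)] at t2
  rw [G.dist_comm (u := h i) (v := c i)] at t3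
  have a1 := it.dist_add 0 i (j + 1) (by omega) (by omega) (by omega)
  have a2 := it.dist_add 0 (j + 1) N (by omega) (by omega) le_rfl
  have a3 := it.dist_add i α (j + 1) (by omega) (by omega) (by omega)
  have a4 := it.dist_add α (β + 1) (j + 1) (by omega) (by omega) (by omega)
  -- If `u` and `v` were already served, the detour through them would give the route excluded by
  -- `hR`: `2 * (μ * T)` for the two ends, `4 * ρ` for reaching the centres, and the error of the
  -- route from `u` to `v`.
  constructor
  · intro r
    apply hR
    have s1 : ∑ l ∈ Ico 0 i, w (c l) ≤ ∑ l ∈ Ico 0 α, w (c l) :=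
      sum_le_sum_of_subset (Ico_subset_Ico le_rfl (by omega))
    have s2 : ∑ l ∈ Ico (j + 1) N, w (c l) ≤ ∑ l ∈ Ico (β + 1) N, w (c l) :=
      sum_le_sum_of_subset (Ico_subset_Ico (by omega) le_rfl)
    refine ((((((it.route (Nat.zero_le i) (by omega)).mono_edges hE).trans
      (ri.symm.mono_edges hE)).trans r).trans (rj.mono_edges hE)).trans
      ((it.route (i := j + 1) (j := N) (by omega) le_rfl).mono_edges hE)).mono ?_
    omega
  · have hE' : E ⊆ insert (h α, h (β + 1)) E' := hE.trans (subset_insert _ _)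
    have s1 : ∑ l ∈ Ico i α, w (c l) ≤ ∑ l ∈ Ico 0 α, w (c l) :=
      sum_le_sum_of_subset (Ico_subset_Ico (Nat.zero_le _) le_rfl)
    have s2 : ∑ l ∈ Ico (β + 1) (j + 1), w (c l) ≤ ∑ l ∈ Ico (β + 1) N, w (c l) :=
      sum_le_sum_of_subset (Ico_subset_Ico le_rfl hjN)
    refine (((((ri.mono_edges hE').trans
      ((it.route (i := i) (j := α) (by omega) hαN.le).mono_edges hE')).trans
      (.single (.inl (mem_insert_self _ _)) le_rfl)).trans
      ((it.route (i := β + 1) (j := j + 1) (by omega) hjN).mono_edges hE')).trans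
      (rj.symm.mono_edges hE')).mono ?_
    omega

end IsItinerary

/-- Few additional edges provide short routes along all itineraries. -/
theorem exists_purchase [Fintype V] [DecidableEq V] {G : SimpleGraph V} (hG : G.Connected)
    (E : Finset (V × V)) (U : Finset V) (w : V → ℕ) (ρ μ T : ℕ) :
    ∃ F : Finset (V × V), T ^ 2 * F.card ≤ (∑ u ∈ U, w u) ^ 2 ∧
      ∀ N h c, G.IsItinerary E U w ρ μ N h c →
        G.Route (E ∪ F) (h 0) (h N) (G.dist (h 0) (h N) + (8 * ρ + 4 * (μ * T))) := by
  classical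
  let S : Finset (V × V) → Finset (V × V) := fun F => (U ×ˢ U).filter fun p =>
    G.Route (E ∪ F) p.1 p.2 (G.dist p.1 p.2 + (4 * ρ + 2 * (μ * T)))
  let Φ : Finset (V × V) → ℕ := fun F => ∑ p ∈ S F, w p.1 * w p.2
  -- An extremal choice replaces greedy buying: comparison with `∅` bounds `F.card`, and comparison
  -- with `insert e F` shows that no further edge gains more than `T ^ 2`.
  obtain ⟨F, -, hF⟩ := exists_max_image (univ : Finset (Finset (V × V)))
    (fun F => (Φ F : ℤ) - T ^ 2 * F.card) univ_nonempty
  refine ⟨F, ?_, fun N h c it => ?_⟩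
  · have h0 := hF ∅ (mem_univ _)
    have h1 : Φ F ≤ (∑ u ∈ U, w u) ^ 2 := by
      rw [sq, sum_mul_sum, ← sum_product']
      exact sum_le_sum_of_subset (filter_subset _ _)
    simp only [card_empty, Nat.cast_zero, mul_zero, sub_zero] at h0
    have h2 : (T : ℤ) ^ 2 * F.card ≤ Φ F := by
      have : (0 : ℤ) ≤ Φ ∅ := Int.natCast_nonneg _
      linarith
    exact le_trans (by exact_mod_cast h2) h1
  · refine (it.route_or_exists_edge hG (subset_union_left (s₂ := F)) T).resolve_right ?_
    rintro ⟨e, A, B, hA, hB, hTA, hTB, hAB⟩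
    have h1 : Φ F + (∑ u ∈ A, w u) * (∑ u ∈ B, w u) ≤ Φ (insert e F) := by
      rw [sum_mul_sum, ← sum_product', ← sum_union]
      · refine sum_le_sum_of_subset fun p hp => ?_
        rcases mem_union.1 hp with hp | hp
        · obtain ⟨h1, h2⟩ := mem_filter.1 hp
          exact mem_filter.2 ⟨h1, h2.mono_edges
            (union_subset_union subset_rfl (subset_insert _ _))⟩
        · obtain ⟨h1, h2⟩ := mem_product.1 hp
          refine mem_filter.2 ⟨mem_product.2 ⟨hA h1, hB h2⟩, ?_⟩
          rw [union_insert]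
          exact (hAB _ h1 _ h2).2
      · refine Finset.disjoint_left.2 fun p hp hp' => ?_
        obtain ⟨h1, h2⟩ := mem_product.1 hp'
        exact (hAB _ h1 _ h2).1 (mem_filter.1 hp).2
    have h2 := hF (insert e F) (mem_univ _)
    have h3 : (insert e F).card ≤ F.card + 1 := card_insert_le _ _
    have h4 : T ^ 2 < (∑ u ∈ A, w u) * (∑ u ∈ B, w u) := by nlinarith
    have h5 : T ^ 2 * (insert e F).card ≤ T ^ 2 * F.card + T ^ 2 :=
      (Nat.mul_le_mul_left _ h3).trans (by rw [mul_add, mul_one])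
    zify at h1 h4 h5
    linarith

end PathBuying

end SimpleGraph

/-! ### One step of the recursion -/

namespace SimpleGraph

open Finset

variable {V : Type*}

/-- An emulator of `G` from emulators of its connected induced subgraphs. -/
theorem Connected.exists_emulator_of_induce [Fintype V] {G : SimpleGraph V} (hG : G.Connected)
    {K J L q k : ℕ} {e : ℕ → ℕ} {B : ℝ} (hJ : Fintype.card V < K ^ J) (hL0 : 0 < L) (hq : 0 < q)
    (hL : 2 * (Fintype.card V : ℝ) ^ 3 * (1 - 1 / q) ^ L ≤ 1)
    (hind : ∀ C : Set V, (G.induce C).Connected → ∃ E : Finset (C × C), E.card ≤ k * Nat.card C ∧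
      ∀ x y, (G.induce C).Route E x y ((G.induce C).dist x y + e (Nat.card C)))
    (he : ∀ m, q ^ 2 < m → (e m : ℝ) ≤ B * m) (hB : 0 ≤ B)
    (hBL : (B * K) ^ 2 * Fintype.card V ≤ (L : ℝ) ^ 2) :
    ∃ E : Finset (V × V), E.card ≤ (3 * K + k * K + 2) * Fintype.card V ∧
      ∀ s t, G.Route E s t (G.dist s t + 24 * 8 ^ J * L) := by
  classical
  obtain ⟨U, rad, c, hc, hrad, hsum⟩ := hG.exists_clustering hJ L
  set n := Fintype.card V with hn
  set Cl : V → Finset V := fun u => G.distBall u (rad u) with hCl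
  set ρ := 8 ^ J * L with hρ
  have hn1 : 1 ≤ n := Fintype.card_pos_iff.2 hG.nonempty
  have hClρ : ∀ u, ∀ x ∈ Cl u, G.dist u x ≤ ρ := fun u x hx => (mem_distBall.1 hx).trans (hrad u)
  obtain ⟨X, hXcard, hX⟩ := hG.exists_milestones (U.filter fun u => (Cl u).card ≤ q ^ 2) Cl hL0 hq hL
  have hconn : ∀ u, (G.induce (Cl u : Set V)).Connected := fun u => hG.induce_distBall u _
  choose R hRcard hR using fun u => hind (Cl u : Set V) (hconn u)
  have hcardCl : ∀ u, Nat.card (Cl u : Set V) = (Cl u).card := fun u => by simp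
  simp only [hcardCl] at hRcard hR
  -- Small clusters are free because `E₂` joins their milestones exactly; large ones cost the error
  -- of their recursive emulator in `E₃`. The stars `E₁` connect centres to their clusters.
  let w : V → ℕ := fun u => if (Cl u).card ≤ q ^ 2 then 0 else e (Cl u).card
  let E₁ : Finset (V × V) := U.biUnion fun u => (Cl u).image fun x => (u, x)
  let E₂ : Finset (V × V) :=
    (U.filter fun u => (Cl u).card ≤ q ^ 2).biUnion fun u => (X ∩ Cl u).offDiag
  let E₃ : Finset (V × V) := U.biUnion fun u => (R u).image fun p => ((p.1 : V), (p.2 : V))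
  have hstar : ∀ v x, G.dist v x ≤ 5 * L → G.Route (E₁ ∪ E₂ ∪ E₃) (c v) x ρ ∧ G.dist (c v) x ≤ ρ := by
    intro v x hx
    have hxC := (hc v).2 x hx
    refine ⟨.single (.inl (mem_union_left _ (mem_union_left _ ?_))) (hClρ _ _ hxC), hClρ _ _ hxC⟩
    exact mem_biUnion.2 ⟨_, (hc v).1, mem_image_of_mem _ hxC⟩
  -- Milestones assigned to one cluster lie within `2 * ρ` of each other on a geodesic with one
  -- milestone per block of length `L`, so `2 * 8 ^ J + 1` bounds the visits. With threshold `L` the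
  -- purchase error stays of order `ρ`.
  obtain ⟨F, hFcard, hF⟩ := exists_purchase hG (E₁ ∪ E₂ ∪ E₃) U w ρ (2 * 8 ^ J + 1) L
  refine ⟨(E₁ ∪ E₂ ∪ E₃) ∪ F, ?_, fun s t => ?_⟩
  · have h1 : E₁.card ≤ K * n := card_biUnion_le.trans ((sum_le_sum fun u _ => card_image_le).trans hsum)
    have h2 : E₂.card ≤ 2 * (K * n) + 1 := by
      refine card_biUnion_le.trans ?_
      have : ∑ u ∈ U.filter (fun u => (Cl u).card ≤ q ^ 2), ((Cl u).card : ℝ) ^ 2 / q ^ 2 ≤ K * n := by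
        calc _ ≤ ∑ u ∈ U.filter (fun u => (Cl u).card ≤ q ^ 2), ((Cl u).card : ℝ) := by
              refine sum_le_sum fun u hu => ?_
              have h : ((Cl u).card : ℝ) ≤ q ^ 2 := by exact_mod_cast (mem_filter.1 hu).2
              rw [div_le_iff₀ (by positivity), sq]
              gcongr
          _ ≤ ∑ u ∈ U, ((Cl u).card : ℝ) :=
              sum_le_sum_of_subset_of_nonneg (filter_subset _ _) fun _ _ _ => by positivity
          _ ≤ K * n := by exact_mod_cast hsum
      have h3 := hXcard.trans (by gcongr : _ ≤ 2 * ((K : ℝ) * n) + 1)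
      exact_mod_cast h3
    have h3 : E₃.card ≤ k * (K * n) :=
      card_biUnion_le.trans ((sum_le_sum fun u _ => card_image_le.trans (hRcard u)).trans
        (by rw [← mul_sum]; exact Nat.mul_le_mul_left k hsum))
    have hW : ((∑ u ∈ U, w u : ℕ) : ℝ) ≤ B * (K * n) := by
      have h4 : ∀ u, (w u : ℝ) ≤ B * (Cl u).card := by
        intro u
        simp only [w]
        split_ifs with h
        · simp only [Nat.cast_zero]; positivity
        · exact he _ (by omega)
      push_cast
      calc ∑ u ∈ U, (w u : ℝ) ≤ ∑ u ∈ U, B * ((Cl u).card : ℝ) := sum_le_sum fun u _ => h4 u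
        _ = B * ((∑ u ∈ U, (Cl u).card : ℕ) : ℝ) := by push_cast; rw [mul_sum]
        _ ≤ B * (K * n) := by
          refine mul_le_mul_of_nonneg_left ?_ hB
          exact_mod_cast hsum
    have h4 : F.card ≤ n := by
      have hL' : (0 : ℝ) < (L : ℝ) ^ 2 := by positivity
      have h5 : (L : ℝ) ^ 2 * F.card ≤ (B * (K * n)) ^ 2 :=
        le_trans (by exact_mod_cast hFcard) (pow_le_pow_left₀ (by positivity) hW 2)
      have h6 : (B * (K * n)) ^ 2 ≤ (L : ℝ) ^ 2 * n := by
        calc (B * (K * n)) ^ 2 = ((B * K) ^ 2 * n) * n := by ring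
          _ ≤ _ := by gcongr
      exact_mod_cast le_of_mul_le_mul_left (h5.trans h6) hL'
    have h5 := card_union_le (E₁ ∪ E₂ ∪ E₃) F
    have h6 := card_union_le (E₁ ∪ E₂) E₃
    have h7 := card_union_le E₁ E₂
    have h8 : (3 * K + k * K + 2) * n = K * n + 2 * (K * n) + k * (K * n) + n + n := by ring
    omega
  have hE : E₁ ∪ E₂ ∪ E₃ ⊆ (E₁ ∪ E₂ ∪ E₃) ∪ F := subset_union_left
  have hLρ : L ≤ ρ := Nat.le_mul_of_pos_left L (by positivity)
  have hlocal : ∀ x y, G.dist x y ≤ 5 * L → G.Route ((E₁ ∪ E₂ ∪ E₃) ∪ F) x y (2 * ρ) := by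
    intro x y hxy
    exact (((hstar x x (by simp)).1.symm.trans (hstar x y hxy).1).mono_edges hE).mono (by omega)
  have hρ' : 24 * 8 ^ J * L = 24 * ρ := by rw [hρ]; ring
  by_cases hst : G.dist s t < L
  · exact (hlocal s t (by omega)).mono (by omega)
  obtain ⟨p, pos, hp0, hpt, hp, hpos⟩ := hX s t
  set D := G.dist s t with hD
  -- The `N + 1` full blocks carry milestones `0, …, N`, hence `N` steps; the last milestone is
  -- within `2 * L` of `t`.
  obtain ⟨N, hN⟩ : ∃ N, D / L = N + 1 :=
    Nat.exists_eq_succ_of_ne_zero (Nat.div_pos (by omega) hL0).ne'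
  have hND : (N + 1) * L ≤ D := hN ▸ Nat.div_mul_le_self D L
  have hDN : D < (N + 2) * L := by
    have := Nat.lt_div_mul_add (a := D) hL0
    rw [hN] at this
    linarith
  have hpos' : ∀ i ≤ N, i * L ≤ pos i ∧ pos i < (i + 1) * L ∧ pos i ≤ D ∧ p (pos i) ∈ X := by
    intro i hi
    have h1 : (i + 1) * L ≤ (N + 1) * L := Nat.mul_le_mul_right L (by omega)
    obtain ⟨h2, h3, h4⟩ := hpos i (h1.trans hND)
    exact ⟨h2, h3, by omega, h4⟩
  have hmono : ∀ i j, i ≤ j → j ≤ N → pos i ≤ pos j := by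
    intro i j hij hj
    rcases hij.eq_or_lt with rfl | hij
    · rfl
    · have h1 := (hpos' i (by omega)).2.1
      have h2 := (hpos' j hj).1
      have h3 : (i + 1) * L ≤ j * L := Nat.mul_le_mul_right L hij
      omega
  have hdist : ∀ i j, i ≤ j → j ≤ N → G.dist (p (pos i)) (p (pos j)) = pos j - pos i :=
    fun i j hij hj => hp _ _ (hmono i j hij hj) (hpos' j hj).2.2.1
  have hnext : ∀ i < N, G.dist (p (pos i)) (p (pos (i + 1))) ≤ 2 * L := by
    intro i hi
    rw [hdist i (i + 1) (by omega) hi]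
    have h1 := (hpos' i (by omega)).1
    have h2 := (hpos' (i + 1) hi).2.1
    have h3 : (i + 1 + 1) * L = i * L + 2 * L := by ring
    omega
  have it : G.IsItinerary (E₁ ∪ E₂ ∪ E₃) U w ρ (2 * 8 ^ J + 1) N (fun i => p (pos i))
      (fun i => c (p (pos i))) := by
    refine ⟨fun i _ => (hc _).1, fun i j k hij hjk hk => ?_, fun i hi => ?_, fun i _ => hstar _ _ (by simp),
      fun i hi => hstar _ _ ((hnext i hi).trans (by omega)), fun I u hI => ?_⟩
    · rw [hdist i k (hij.trans hjk) hk, hdist i j hij (hjk.trans hk), hdist j k hjk hk]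
      have := hmono i j hij (hjk.trans hk)
      have := hmono j k hjk hk
      omega
    · have hx := (hc (p (pos i))).2 (p (pos i)) (by simp)
      have hy := (hc (p (pos i))).2 (p (pos (i + 1))) ((hnext i hi).trans (by omega))
      have hxX := (hpos' i (by omega)).2.2.2
      have hyX := (hpos' (i + 1) hi).2.2.2
      by_cases hsmall : (Cl (c (p (pos i)))).card ≤ q ^ 2
      · by_cases hxy : p (pos i) = p (pos (i + 1))
        · rw [← hxy]
          exact .refl _ _
        · refine Route.mono (.single (.inl (mem_union_left _ (mem_union_right _ ?_))) le_rfl)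
            (Nat.le_add_right _ _)
          exact mem_biUnion.2 ⟨_, mem_filter.2 ⟨(hc _).1, hsmall⟩,
            mem_offDiag.2 ⟨mem_inter.2 ⟨hxX, hx⟩, mem_inter.2 ⟨hyX, hy⟩, hxy⟩⟩
      · have hd := (hG.dist_induce_le_of_ball (C := (Cl (c (p (pos i))) : Set V))
          (mem_coe.2 hx) (mem_coe.2 hy) fun v hv => mem_coe.2 ((hc _).2 v
            (hv.trans ((hnext i hi).trans (by omega))))).2
        refine ((hR _ ⟨_, mem_coe.2 hx⟩ ⟨_, mem_coe.2 hy⟩).map (G := G) (E := E₁ ∪ E₂ ∪ E₃) Subtype.val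
          (fun a b => (hconn _).dist_le_dist_induce a b) fun a b hab => ?_).mono ?_
        · exact mem_union_right _ (mem_biUnion.2 ⟨_, (hc _).1, mem_image_of_mem _ hab⟩)
        · simp only [w, if_neg hsmall]
          omega
    · rcases I.eq_empty_or_nonempty with rfl | hne
      · simp
      · have hmin := hI _ (I.min'_mem hne)
        set a := I.min' hne with ha
        have hsub : I ⊆ Ico a (a + (2 * 8 ^ J + 1)) := by
          intro i hi
          have hai : a ≤ i := I.min'_le i hi
          refine mem_Ico.2 ⟨hai, ?_⟩
          obtain ⟨hiN, hiu⟩ := hI i hi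
          have d1 := (hstar (p (pos i)) (p (pos i)) (by simp)).2
          have d2 := (hstar (p (pos a)) (p (pos a)) (by simp)).2
          rw [hiu] at d1
          rw [hmin.2, G.dist_comm] at d2
          have d3 := hG.dist_triangle (u := p (pos a)) (v := u) (w := p (pos i))
          rw [hdist a i hai hiN.le] at d3
          have e1 := (hpos' i hiN.le).1
          have e2 := (hpos' a hmin.1.le).2.1
          have e3 : (a + (2 * 8 ^ J + 1)) * L = (a + 1) * L + 2 * ρ := by rw [hρ]; ring
          exact lt_of_mul_lt_mul_right (by omega : i * L < (a + (2 * 8 ^ J + 1)) * L) (Nat.zero_le L)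
        simpa using card_le_card hsub
  have hroute := hF N _ _ it
  beta_reduce at hroute
  have hs : G.dist s (p (pos 0)) = pos 0 := by
    have := hp 0 (pos 0) (Nat.zero_le _) (hpos' 0 (by omega)).2.2.1
    rw [hp0] at this
    omega
  have ht : G.dist (p (pos N)) t = D - pos N := by
    have := hp (pos N) D (hpos' N le_rfl).2.2.1 le_rfl
    rwa [hpt] at this
  have hsN := hdist 0 N (Nat.zero_le _) le_rfl
  have b1 := (hpos' 0 (by omega)).2.1
  have b2 := hpos' N le_rfl
  have b3 : (N + 2) * L = N * L + 2 * L := by ring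
  have b4 : (2 * 8 ^ J + 1) * L = 2 * ρ + L := by rw [hρ]; ring
  -- The error is `2 * ρ` at each end plus `8 * ρ + 4 * (2 * ρ + L)`, at most `24 * ρ`.
  refine (((hlocal s (p (pos 0)) (by omega)).trans hroute).trans
    (hlocal (p (pos N)) t (by omega))).mono ?_
  omega

end SimpleGraph

/-! ### Bootstrapping the exponent -/

namespace SimpleGraph

open Finset Filter

universe u

/-- Connected graphs on `n` vertices have emulators of linear size with additive error `O(n ^ a)`. -/
def IsEmulatorExponent (a : ℝ) : Prop :=
  ∃ K : ℕ, ∀ (V : Type u) [Fintype V] (G : SimpleGraph V), G.Connected →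
    ∃ E : Finset (V × V), E.card ≤ K * Fintype.card V ∧
      ∀ s t, G.Route E s t (G.dist s t + ⌊(K : ℝ) * (Fintype.card V : ℝ) ^ a⌋₊)

theorem isEmulatorExponent_one : IsEmulatorExponent.{u} 1 := by
  classical
  refine ⟨2, fun V _ G hG => ?_⟩
  obtain ⟨o⟩ := hG.nonempty
  refine ⟨univ.image fun v => (o, v), card_image_le.trans (by rw [card_univ]; omega), fun s t => ?_⟩
  have hmem : ∀ v : V, (o, v) ∈ univ.image fun v : V => (o, v) := fun v => mem_image_of_mem _ (mem_univ v)
  refine ((Route.single (.inr (hmem s)) le_rfl).trans (Route.single (.inl (hmem t)) le_rfl)).mono ?_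
  have h1 := hG.dist_lt_card s o
  have h2 := hG.dist_lt_card o t
  rw [Real.rpow_one, show ((2 : ℕ) : ℝ) * (Fintype.card V : ℝ) = ((2 * Fintype.card V : ℕ) : ℝ) by
    push_cast; ring, Nat.floor_natCast]
  omega

/-- Take `L ≈ n ^ x` and `q ≈ n ^ (x - δ)`. Then `L / q ≥ 4 * log n`, so `(1 - 1 / q) ^ L ≤ n ^
(-4)`. With `n ^ (4 * δ)` absorbing `A ^ 2`, the last bound needs `1 + 4 * δ + 4 * δ * (1 - a) ≤ (6
- 4 * a) * x`, which holds as the right side is `1 + 8 * δ` and `a ≥ 0`. -/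
theorem exists_eventually_parameters {a x δ : ℝ} (ha : a ≤ 1) (ha0 : 0 ≤ a) (hδ : 0 < δ)
    (hδx : δ ≤ x) (hx : (6 - 4 * a) * x = 1 + 8 * δ) (A : ℝ) :
    ∀ᶠ n : ℕ in atTop, ∃ L q : ℕ, 0 < L ∧ 0 < q ∧ (L : ℝ) ≤ 2 * (n : ℝ) ^ x ∧
      2 * (n : ℝ) ^ 3 * (1 - 1 / q) ^ L ≤ 1 ∧
      (A * (q : ℝ) ^ (2 * (a - 1))) ^ 2 * n ≤ (L : ℝ) ^ 2 := by
  have hlog : ∀ᶠ n : ℕ in atTop, Real.log n ≤ 1 / 8 * (n : ℝ) ^ δ := by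
    have h := ((isLittleO_log_rpow_atTop hδ).comp_tendsto tendsto_natCast_atTop_atTop).bound
      (by norm_num : (0 : ℝ) < 1 / 8)
    filter_upwards [h] with n hn
    simp only [Function.comp_apply, Real.norm_eq_abs] at hn
    rw [abs_of_nonneg (Real.rpow_nonneg (Nat.cast_nonneg n) δ)] at hn
    exact (le_abs_self _).trans hn
  have hA : ∀ᶠ n : ℕ in atTop, A ^ 2 ≤ (n : ℝ) ^ (4 * δ) :=
    ((tendsto_rpow_atTop (by positivity)).comp tendsto_natCast_atTop_atTop).eventually_ge_atTop _
  filter_upwards [hlog, hA, eventually_ge_atTop 2] with n hlog hA hn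
  have hn1 : (1 : ℝ) ≤ n := by exact_mod_cast (by omega : 1 ≤ n)
  have hn0 : (0 : ℝ) < n := by linarith
  have hceil : ∀ z : ℝ, 0 ≤ z → (⌈(n : ℝ) ^ z⌉₊ : ℝ) ≤ 2 * (n : ℝ) ^ z := by
    intro z hz
    have h1 := Real.one_le_rpow hn1 hz
    have h2 := Nat.ceil_lt_add_one (by linarith : 0 ≤ (n : ℝ) ^ z)
    linarith
  have hx0 : 0 ≤ x := by linarith
  refine ⟨⌈(n : ℝ) ^ x⌉₊, ⌈(n : ℝ) ^ (x - δ)⌉₊, Nat.ceil_pos.2 (by positivity),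
    Nat.ceil_pos.2 (by positivity), hceil x hx0, ?_, ?_⟩
  · have hL := Nat.le_ceil ((n : ℝ) ^ x)
    have hq := hceil (x - δ) (by linarith)
    have hq0 : (0 : ℝ) < ⌈(n : ℝ) ^ (x - δ)⌉₊ := by exact_mod_cast Nat.ceil_pos.2 (by positivity)
    have hq1 : (1 : ℝ) ≤ ⌈(n : ℝ) ^ (x - δ)⌉₊ := by
      exact_mod_cast Nat.ceil_pos.2 (by positivity)
    generalize (⌈(n : ℝ) ^ x⌉₊) = L at *
    generalize (⌈(n : ℝ) ^ (x - δ)⌉₊) = q at *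
    have h1 : (n : ℝ) ^ δ / 2 ≤ L * (1 / q) := by
      rw [mul_one_div, div_le_div_iff₀ (by norm_num) hq0]
      calc (n : ℝ) ^ δ * q ≤ (n : ℝ) ^ δ * (2 * (n : ℝ) ^ (x - δ)) := by gcongr
        _ = (n : ℝ) ^ (δ + (x - δ)) * 2 := by rw [Real.rpow_add hn0]; ring
        _ ≤ L * 2 := by
          rw [show δ + (x - δ) = x by ring]
          linarith
    have h01 : (0 : ℝ) ≤ 1 - 1 / q := by
      have : (1 : ℝ) / q ≤ 1 := by rwa [div_le_one hq0]
      linarith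
    have h2 : (1 - 1 / q : ℝ) ^ L ≤ ((n : ℝ) ^ 4)⁻¹ := by
      calc (1 - 1 / q : ℝ) ^ L ≤ (Real.exp (-(1 / q))) ^ L := by
            gcongr
            linarith [Real.add_one_le_exp (-(1 / (q : ℝ)))]
        _ = Real.exp (-(L * (1 / q))) := by rw [← Real.exp_nat_mul]; ring_nf
        _ ≤ Real.exp (-(4 * Real.log n)) := by
            apply Real.exp_le_exp.2
            linarith
        _ = ((n : ℝ) ^ 4)⁻¹ := by
            rw [Real.exp_neg, show 4 * Real.log n = ((4 : ℕ) : ℝ) * Real.log n by norm_num,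
              Real.exp_nat_mul, Real.exp_log hn0]
    calc 2 * (n : ℝ) ^ 3 * (1 - 1 / (q : ℝ)) ^ L ≤ 2 * (n : ℝ) ^ 3 * ((n : ℝ) ^ 4)⁻¹ := by gcongr
      _ = 2 / (n : ℝ) := by field_simp
      _ ≤ 1 := by
        rw [div_le_one hn0]
        exact_mod_cast hn
  · have hL := Nat.le_ceil ((n : ℝ) ^ x)
    have hq := Nat.le_ceil ((n : ℝ) ^ (x - δ))
    generalize (⌈(n : ℝ) ^ x⌉₊) = L at *
    generalize (⌈(n : ℝ) ^ (x - δ)⌉₊) = q at *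
    have h1 : (q : ℝ) ^ (2 * (a - 1)) ≤ (n : ℝ) ^ ((x - δ) * (2 * (a - 1))) := by
      rw [Real.rpow_mul hn0.le]
      exact Real.rpow_le_rpow_of_nonpos (by positivity) hq (by linarith)
    have h2 : 0 ≤ (q : ℝ) ^ (2 * (a - 1)) := by positivity
    calc (A * (q : ℝ) ^ (2 * (a - 1))) ^ 2 * n = A ^ 2 * ((q : ℝ) ^ (2 * (a - 1))) ^ 2 * n := by ring
      _ ≤ (n : ℝ) ^ (4 * δ) * ((n : ℝ) ^ ((x - δ) * (2 * (a - 1)))) ^ 2 * n := by gcongr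
      _ = (n : ℝ) ^ (4 * δ + (x - δ) * (2 * (a - 1)) * 2 + 1) := by
        rw [Real.rpow_add hn0, Real.rpow_add hn0, Real.rpow_one, Real.rpow_mul hn0.le _ 2,
          Real.rpow_two]
      _ ≤ (n : ℝ) ^ (x * 2) := by
        apply Real.rpow_le_rpow_of_exponent_le hn1
        nlinarith
      _ = ((n : ℝ) ^ x) ^ 2 := by rw [Real.rpow_mul hn0.le, Real.rpow_two]
      _ ≤ (L : ℝ) ^ 2 := by gcongr

/-- The gap between `x` and `y` pays for the cluster radii: with the constant growth factor `8 ^ (r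
+ 1)`, about `log n / log (8 ^ (r + 1))` scales suffice, so `8 ^ J ≤ 8 * n ^ (1 / (r + 1))`. -/
theorem IsEmulatorExponent.improve {a y : ℝ} (h : IsEmulatorExponent.{u} a) (ha0 : 0 ≤ a)
    (ha : a ≤ 1) (hy : 1 < (6 - 4 * a) * y) : IsEmulatorExponent.{u} y := by
  classical
  obtain ⟨k, hk⟩ := h
  have h6 : 0 < 6 - 4 * a := by linarith
  obtain ⟨x, hx1, hxy⟩ : ∃ x, 1 < (6 - 4 * a) * x ∧ x < y := by
    refine ⟨((6 - 4 * a)⁻¹ + y) / 2, ?_, ?_⟩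
    · rw [mul_div_assoc', mul_add, mul_inv_cancel₀ h6.ne']
      linarith
    · have : (6 - 4 * a)⁻¹ < y := by rwa [inv_lt_iff_one_lt_mul₀' h6]
      linarith
  have hx0 : 0 < x := by
    by_contra! hx0
    nlinarith
  set δ := ((6 - 4 * a) * x - 1) / 8 with hδ
  obtain ⟨r, hr⟩ := exists_nat_one_div_lt (sub_pos.2 hxy)
  obtain ⟨n₀, hn₀⟩ := eventually_atTop.1 (exists_eventually_parameters ha ha0 (δ := δ) (x := x)
    (by linarith) (by nlinarith) (by rw [hδ]; ring) (k * (8 ^ (r + 1) : ℕ)))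
  refine ⟨n₀ + (3 * 8 ^ (r + 1) + k * 8 ^ (r + 1) + 2) + 384, fun V _ G hG => ?_⟩
  have hcard : 1 ≤ Fintype.card V := Fintype.card_pos_iff.2 hG.nonempty
  by_cases hsmall : Fintype.card V < n₀
  · refine ⟨univ, ?_, fun s t => (Route.single (.inl (mem_univ _)) le_rfl).mono (Nat.le_add_right _ _)⟩
    rw [card_univ, Fintype.card_prod]
    exact Nat.mul_le_mul_right _ (by omega)
  obtain ⟨L, q, hL0, hq0, hL, hLq, hBL⟩ := hn₀ _ (not_lt.1 hsmall)
  have hJ := Nat.lt_pow_succ_log_self (b := 8 ^ (r + 1)) (Nat.one_lt_pow (by omega) (by norm_num))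
    (Fintype.card V)
  set l := Nat.log (8 ^ (r + 1)) (Fintype.card V) with hl
  set n := Fintype.card V with hn
  have hn1 : (1 : ℝ) ≤ n := by exact_mod_cast hcard
  have hn0 : (0 : ℝ) < n := by linarith
  obtain ⟨E, hE, hroute⟩ := hG.exists_emulator_of_induce (k := k)
    (e := fun m => ⌊(k : ℝ) * (m : ℝ) ^ a⌋₊) (B := k * (q : ℝ) ^ (2 * (a - 1))) hJ hL0 hq0 hLq
    (fun C hC => by
      obtain ⟨E, h1, h2⟩ := hk C (G.induce C) hC
      rw [Nat.card_eq_fintype_card]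
      exact ⟨E, h1, h2⟩)
    (fun m hm => by
      have hm0 : (0 : ℝ) < m := by exact_mod_cast (by omega : 0 < m)
      refine (Nat.floor_le (by positivity)).trans ?_
      rw [mul_assoc]
      refine mul_le_mul_of_nonneg_left ?_ (Nat.cast_nonneg k)
      have hq : (0 : ℝ) < q := by exact_mod_cast hq0
      calc (m : ℝ) ^ a = (m : ℝ) ^ (a - 1) * m := by
            rw [← Real.rpow_add_one hm0.ne', sub_add_cancel]
        _ ≤ ((q : ℝ) ^ 2) ^ (a - 1) * m := by
            refine mul_le_mul_of_nonneg_right ?_ hm0.le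
            exact Real.rpow_le_rpow_of_nonpos (by positivity) (by exact_mod_cast hm.le) (by linarith)
        _ = (q : ℝ) ^ (2 * (a - 1)) * m := by rw [Real.rpow_mul hq.le, Real.rpow_two])
    (by positivity)
    (by
      refine le_trans (le_of_eq ?_) hBL
      ring)
  refine ⟨E, hE.trans (Nat.mul_le_mul_right _ (by omega)), fun s t => (hroute s t).mono ?_⟩
  refine Nat.add_le_add_left (Nat.le_floor ?_) _
  have h8 : ((8 ^ l : ℕ) : ℝ) ≤ (n : ℝ) ^ (y - x) := by
    have h1 : (8 ^ l) ^ (r + 1) ≤ n := by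
      rw [← pow_mul, mul_comm, pow_mul]
      exact Nat.pow_log_le_self _ (by omega)
    calc ((8 ^ l : ℕ) : ℝ) = (((8 ^ l : ℕ) : ℝ) ^ (r + 1)) ^ (((r + 1 : ℕ) : ℝ)⁻¹) :=
          (Real.pow_rpow_inv_natCast (by positivity) (by omega)).symm
      _ ≤ (n : ℝ) ^ (((r + 1 : ℕ) : ℝ)⁻¹) := by
          gcongr
          exact_mod_cast h1
      _ ≤ (n : ℝ) ^ (y - x) := by
          apply Real.rpow_le_rpow_of_exponent_le hn1
          push_cast
          rw [← one_div]
          exact hr.le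
  have hxy' : (n : ℝ) ^ y = (n : ℝ) ^ (y - x) * (n : ℝ) ^ x := by
    rw [← Real.rpow_add hn0, sub_add_cancel]
  calc ((24 * 8 ^ (l + 1) * L : ℕ) : ℝ) = 192 * ((8 ^ l : ℕ) : ℝ) * L := by push_cast; ring
    _ ≤ 192 * (n : ℝ) ^ (y - x) * (2 * (n : ℝ) ^ x) := by gcongr
    _ = 384 * (n : ℝ) ^ y := by rw [hxy']; ring
    _ ≤ _ := by
      gcongr
      exact_mod_cast Nat.le_add_left _ _

theorem exists_isEmulatorExponent_lt {z : ℝ} (hz : 1 / (3 + Real.sqrt 5) < z) :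
    ∃ a < z, 0 ≤ a ∧ IsEmulatorExponent.{u} a := by
  set A : Set ℝ := {a | 0 ≤ a ∧ a ≤ 1 ∧ IsEmulatorExponent.{u} a} with hA
  have hne : A.Nonempty := ⟨1, zero_le_one, le_rfl, isEmulatorExponent_one⟩
  have hbdd : BddBelow A := ⟨0, fun a ha => ha.1⟩
  suffices h : sInf A ≤ 1 / (3 + Real.sqrt 5) by
    obtain ⟨a, ha, haz⟩ := exists_lt_of_csInf_lt hne (h.trans_lt hz)
    exact ⟨a, haz, ha.1, ha.2.2⟩
  by_contra! hlt
  set b := sInf A with hb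
  have hb1 : b ≤ 1 := csInf_le hbdd ⟨zero_le_one, le_rfl, isEmulatorExponent_one⟩
  have h5 : Real.sqrt 5 ^ 2 = 5 := Real.sq_sqrt (by norm_num)
  have h5' : 2 < Real.sqrt 5 := Real.lt_sqrt_of_sq_lt (by norm_num)
  have hinv : 1 / (3 + Real.sqrt 5) = (3 - Real.sqrt 5) / 4 := by
    rw [div_eq_div_iff (by positivity) (by norm_num)]
    nlinarith
  rw [hinv] at hlt
  -- `b` lies strictly between the roots `(3 ± √5) / 4` of `(6 - 4 * b) * b = 1`, the larger one
  -- exceeding `1`.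
  have hpos : 0 < (6 - 4 * b) * b - 1 := by
    have : 0 < (b - (3 - Real.sqrt 5) / 4) * ((3 + Real.sqrt 5) / 4 - b) :=
      mul_pos (by linarith) (by linarith)
    nlinarith
  -- The `7` gives `(6 - 4 * (b + η)) * (b - η) = 1 + η + 4 * η ^ 2 > 1`, so an exponent below `b +
  -- η` improves to `b - η`.
  set η := ((6 - 4 * b) * b - 1) / 7 with hη
  have hη0 : 0 < η := by positivity
  have hb0 : 0 ≤ b := le_csInf hne fun a ha => ha.1
  obtain ⟨a, ⟨ha0, ha1, ha⟩, hab⟩ := exists_lt_of_csInf_lt hne (by linarith : sInf A < b + η)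
  have hηb : η < b := by nlinarith
  have hy : 1 < (6 - 4 * a) * (b - η) := by
    have h1 : (6 - 4 * (b + η)) * (b - η) ≤ (6 - 4 * a) * (b - η) :=
      mul_le_mul_of_nonneg_right (by linarith) (by linarith)
    nlinarith [sq_nonneg η]
  have := csInf_le hbdd (show b - η ∈ A from ⟨by linarith, by linarith, ha.improve ha0 ha1 hy⟩)
  linarith

/-! ### Components and the final theorem -/

/-- Emulators of a graph are obtained from emulators of its connected components. -/
theorem IsEmulatorExponent.exists_pairs {a : ℝ} (h : IsEmulatorExponent.{u} a) (ha : 0 ≤ a) :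
    ∃ K : ℕ, ∀ (V : Type u) [Fintype V] (G : SimpleGraph V), ∃ E : Finset (V × V),
      E.card ≤ K * Fintype.card V ∧ (∀ x y, (x, y) ∈ E → G.Reachable x y) ∧
      ∀ s t, G.Reachable s t → ∃ m : ℕ, (m : ℝ) ≤ K * (Fintype.card V : ℝ) ^ a ∧
        G.Route E s t (G.dist s t + m) := by
  classical
  obtain ⟨K, hK⟩ := h
  refine ⟨K, fun V _ G => ?_⟩
  have hconn : ∀ c : G.ConnectedComponent, (G.induce c.supp).Connected :=
    fun c => c.connected_toSimpleGraph
  choose R hcard hR using fun c : G.ConnectedComponent => hK c.supp (G.induce c.supp) (hconn c)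
  refine ⟨univ.biUnion fun c => (R c).image fun p => ((p.1 : V), (p.2 : V)), ?_, ?_, ?_⟩
  · have hsum : ∑ c : G.ConnectedComponent, Fintype.card c.supp = Fintype.card V := by
      rw [← Fintype.card_sigma]
      exact Fintype.card_congr (Equiv.sigmaFiberEquiv G.connectedComponentMk)
    calc _ ≤ ∑ c : G.ConnectedComponent, K * Fintype.card c.supp :=
          card_biUnion_le.trans (sum_le_sum fun c _ => card_image_le.trans (hcard c))
      _ = K * Fintype.card V := by rw [← mul_sum, hsum]
  · intro x y hxy
    obtain ⟨c, -, hc⟩ := mem_biUnion.1 hxy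
    obtain ⟨⟨⟨x', hx⟩, ⟨y', hy⟩⟩, -, he⟩ := mem_image.1 hc
    obtain ⟨rfl, rfl⟩ := Prod.mk.inj he
    exact ConnectedComponent.exact (Eq.trans hx (Eq.symm hy))
  · intro s t hst
    set c := G.connectedComponentMk s with hc
    obtain ⟨p, hp⟩ := hst.exists_walk_length_eq_dist
    have hsupp : ∀ v ∈ p.support, v ∈ c.supp := fun v hv =>
      (ConnectedComponent.sound ⟨p.takeUntil v hv⟩).symm
    have hd := (dist_induce_le p hsupp).2
    refine ⟨⌊(K : ℝ) * (Fintype.card c.supp : ℝ) ^ a⌋₊, ?_, ?_⟩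
    · refine (Nat.floor_le (by positivity)).trans ?_
      gcongr
      exact Fintype.card_subtype_le _
    · refine ((hR c ⟨s, hsupp s (by simp)⟩ ⟨t, hsupp t (by simp)⟩).map (G := G) Subtype.val
        (fun x y => (hconn c).dist_le_dist_induce x y) fun x y hxy => ?_).mono (by omega)
      exact mem_biUnion.2 ⟨c, mem_univ _, mem_image_of_mem _ hxy⟩

end SimpleGraph

open SimpleGraph WeightedGraph in
theorem mainTheorem1 :
    ∃ C : ℝ≥0, ∀ ε : ℝ, 0 < ε → ∃ K : ℝ≥0,
      ∀ (V : Type*) [Fintype V] (G : SimpleGraph V),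
        ∃ H : WeightedGraph V,
          H.IsAdditiveEmulator G
            (C * (Fintype.card V : ℝ≥0) ^ (1 / (3 + Real.sqrt 5) + ε)) ∧
          (H.numEdges : ℝ≥0) ≤ K * (Fintype.card V : ℝ≥0) := by
  classical
  -- `C = 1` suffices: for large `n` half of `ε` absorbs the factor `K`, and graphs with `n ≤ n₀`
  -- keep all reachable pairs, at most `n₀ * n` edges.
  refine ⟨1, fun ε hε => ?_⟩
  obtain ⟨a, haz, ha0, ha⟩ := exists_isEmulatorExponent_lt
    (by linarith : 1 / (3 + Real.sqrt 5) < 1 / (3 + Real.sqrt 5) + ε / 2)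
  obtain ⟨K, hK⟩ := ha.exists_pairs ha0
  obtain ⟨n₀, hn₀⟩ := Filter.eventually_atTop.1
    (((tendsto_rpow_atTop (by positivity : 0 < ε / 2)).comp
      tendsto_natCast_atTop_atTop).eventually_ge_atTop (K : ℝ))
  refine ⟨((n₀ + K : ℕ) : ℝ≥0), fun V _ G => ?_⟩
  by_cases hsmall : Fintype.card V ≤ n₀
  · refine ⟨ofPairs G (Finset.univ.filter fun p => G.Reachable p.1 p.2),
      isAdditiveEmulator_ofPairs (fun x y hxy => (Finset.mem_filter.1 hxy).2) fun s t hst =>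
        ⟨0, by simp, .single (.inl (Finset.mem_filter.2 ⟨Finset.mem_univ _, hst⟩)) (by simp)⟩, ?_⟩
    have h1 := (numEdges_ofPairs_le G (Finset.univ.filter fun p => G.Reachable p.1 p.2)).trans
      (Finset.card_le_univ _)
    rw [Fintype.card_prod] at h1
    exact_mod_cast h1.trans (Nat.mul_le_mul_right _ (by omega))
  · obtain ⟨E, hE, hreach, hroute⟩ := hK V G
    refine ⟨ofPairs G E, isAdditiveEmulator_ofPairs hreach fun s t hst => ?_, ?_⟩
    · obtain ⟨m, hm, r⟩ := hroute s t hst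
      refine ⟨m, ?_, r⟩
      have hn : (1 : ℝ) ≤ Fintype.card V := by
        exact_mod_cast (by omega : 1 ≤ Fintype.card V)
      have hKn : (K : ℝ) ≤ (Fintype.card V : ℝ) ^ (ε / 2) := hn₀ _ (by omega)
      rw [← NNReal.coe_le_coe]
      push_cast
      rw [one_mul]
      calc (m : ℝ) ≤ K * (Fintype.card V : ℝ) ^ a := hm
        _ ≤ (Fintype.card V : ℝ) ^ (ε / 2) * (Fintype.card V : ℝ) ^ (1 / (3 + Real.sqrt 5) + ε / 2) := by
          gcongr
        _ = (Fintype.card V : ℝ) ^ (1 / (3 + Real.sqrt 5) + ε) := by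
          rw [← Real.rpow_add (by linarith)]
          ring_nf
    · have h1 := (numEdges_ofPairs_le G E).trans hE
      exact_mod_cast h1.trans (Nat.mul_le_mul_right _ (by omega))
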